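/- A media file of size $F\in[0,\infty]$ is streamed from a single server. Packets arrive according to a Poisson process $(N_t)_{t\ge 0}$ of rate $R>1$ (with nondecreasing right-continuous paths and $N_0=0$), playback has unit rate, and $D\ge 0$ is the initial buffer size, so that the buffer size at time $t$ is $x_t=D+N_t-t$. Let $$\tau_e=\inf\{t\ge 0: x_t\le 0\},\qquad \tau_f=\inf\{t\ge 0: x_t\ge F-t\},\qquad p(D)=\Pr\{\tau_e<\tau_f\}$$ (with $\inf\emptyset=\infty$) be the time at which the buffer runs empty, the time at which the download is complete, and the interruption probability. Let $\gamma(r)=r+R(e^{-r}-1)$ and let $\bar r(R)=\sup\{r\in\mathbb R:\gamma(r)=0\}$ be its largest root. Then, if $F<\infty$, $$e^{-\bar r(R)D}-2e^{-\frac{(R-1)^2}{4(R+1)}F}\;\le\; p(D)\;\le\; e^{-\bar r(R)D},$$ and if $F=\infty$, $$p(D)=\Pr\{x_t\le 0\text{ for some }t\ge 0\}=e^{-\bar r(R)D}.$$ -/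

import Mathlib

open MeasureTheory ProbabilityTheory
open scoped NNReal ENNReal

namespace Streaming

/-- `N` is a (homogeneous) Poisson process of rate `R` under `P`: a counting process that almost
surely starts at `0` and has nondecreasing right-continuous paths, whose increments are independent
and Poisson distributed, `N t - N s` having mean `R (t - s)` for `s ≤ t`. -/
structure IsPoissonProcess {Ω : Type*} [MeasurableSpace Ω]
    (N : ℝ≥0 → Ω → ℕ) (R : ℝ≥0) (P : Measure Ω) : Prop where
  start_zero : ∀ᵐ ω ∂P, N 0 ω = 0
  monotone_paths : ∀ᵐ ω ∂P, Monotone (fun t => N t ω)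
  right_continuous : ∀ᵐ ω ∂P, ∀ t, ContinuousWithinAt (fun s => N s ω) (Set.Ici t) t
  law_increments : ∀ s t : ℝ≥0, s ≤ t →
    HasLaw (fun ω => (N t ω : ℝ) - (N s ω : ℝ))
      ((poissonMeasure (R * (t - s))).map (Nat.cast : ℕ → ℝ)) P
  indep_increments : HasIndepIncrements (fun t ω => (N t ω : ℝ)) P

section Buffer

variable {Ω : Type*} (N : ℝ≥0 → Ω → ℕ) (D : ℝ≥0)

/-- The buffer size `x_t = D + N_t - t`: initial buffer `D`, plus the packets received up to
time `t`, minus what has been played at unit rate. -/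
noncomputable def bufferSize (t : ℝ≥0) (ω : Ω) : ℝ :=
  (D : ℝ) + (N t ω : ℝ) - (t : ℝ)

/-- The time `τ_e = inf {t : x_t ≤ 0}` at which the buffer runs empty (`∞` if it never does). -/
noncomputable def emptyTime (ω : Ω) : ℝ≥0∞ :=
  ⨅ (t : ℝ≥0) (_ : bufferSize N D t ω ≤ 0), (t : ℝ≥0∞)

/-- The time `τ_f = inf {t : x_t ≥ F - t}` at which the download of a file of size `F` is complete
(`∞` if it never is, in particular if `F = ∞`). -/
noncomputable def finishTime (F : ℝ≥0∞) (ω : Ω) : ℝ≥0∞ :=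
  ⨅ (t : ℝ≥0) (_ : (F : EReal) - ((t : ℝ) : EReal) ≤ ((bufferSize N D t ω : ℝ) : EReal)),
    (t : ℝ≥0∞)

/-- The interruption probability `p(D) = P (τ_e < τ_f)` for the file size `F`. -/
noncomputable def interruptionProb [MeasurableSpace Ω] (P : Measure Ω) (F : ℝ≥0∞) : ℝ :=
  P.real {ω | emptyTime N D ω < finishTime N D F ω}

end Buffer

/-- `γ(r) = r + R (e^{-r} - 1)`. -/
noncomputable def gammaFun (R r : ℝ) : ℝ :=
  r + R * (Real.exp (-r) - 1)

/-- The largest root `sup {r : γ(r) = 0}` of `γ`. -/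
noncomputable def rBar (R : ℝ) : ℝ :=
  sSup {r : ℝ | gammaFun R r = 0}

/-- The supremum defining `rBar` is attained. -/
theorem isGreatest_rBar {R : ℝ} (hR : 0 ≤ R) : IsGreatest {r : ℝ | gammaFun R r = 0} (rBar R) := by
  have hb : BddAbove {r : ℝ | gammaFun R r = 0} := by
    refine ⟨R, fun r hr => ?_⟩
    have h1 : r + R * (Real.exp (-r) - 1) = 0 := hr
    nlinarith [mul_nonneg hR (Real.exp_pos (-r)).le]
  have hn : {r : ℝ | gammaFun R r = 0}.Nonempty := ⟨0, by simp [gammaFun]⟩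
  have hc : IsClosed {r : ℝ | gammaFun R r = 0} :=
    isClosed_eq (by unfold gammaFun; fun_prop) continuous_const
  exact ⟨hc.csSup_mem hn hb, fun r hr => le_csSup hb hr⟩

end Streaming

/-! Write `r` for `rBar R`. Since `γ(r) = 0`, the process `exp (-r (N_t - t))` is a mean-one
martingale. If it is stopped when the buffer empties, where `N_t - t = -D`, optional stopping gives
emptying probability `e^{-rD}`, as long as surviving paths contribute nothing in the limit. They do
not: survival means `N_t - t > -D`, so up to a constant the weight is at most the one with exponent
`log R`, whose mean decays because `γ(log R) < 0`.

Stopping is done on grids of mesh `δ`, where the walk has independent steps.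
`mul_measure_stop_add_le` gives upper bounds, extended to all times by right continuity.
`le_mul_measure_stop_add` gives the lower bound, with an overshoot of at most `δ`.

For finite `F`, a path that empties at time `t`, but not before completion, has `F ≤ D + N_t ≤ t`.
So `N_t ≤ t` at some `t ≥ F`, and the maximal inequality with exponent `log R` makes this
exponentially unlikely. -/

namespace Streaming

/-! ### Optional stopping in discrete time -/

section Stopping

variable {Ω : Type*} [MeasurableSpace Ω] {P : Measure Ω} {M : ℕ → Ω → ℝ≥0∞} {G : ℕ → Set Ω}

/-- Splitting off the paths that stop between `n` and `n + 1`. -/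
theorem setLIntegral_eq_add_of_stop (hG : ∀ n, MeasurableSet (G n)) (hanti : Antitone G)
    (hM : ∀ n, ∫⁻ ω in G n, M (n + 1) ω ∂P = ∫⁻ ω in G n, M n ω ∂P) (n : ℕ) :
    ∫⁻ ω in G n, M n ω ∂P =
      ∫⁻ ω in G (n + 1), M (n + 1) ω ∂P + ∫⁻ ω in G n \ G (n + 1), M (n + 1) ω ∂P := by
  rw [← hM, ← lintegral_inter_add_sdiff _ (G n) (hG (n + 1)),
    Set.inter_eq_right.2 (hanti n.le_succ)]

theorem measure_compl_succ_of_antitone (hG : ∀ n, MeasurableSet (G n)) (hanti : Antitone G)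
    (n : ℕ) : P (G (n + 1))ᶜ = P (G n)ᶜ + P (G n \ G (n + 1)) := by
  rw [← measure_union _ ((hG n).diff (hG (n + 1)))]
  · congr 1
    ext ω
    have : ω ∈ G (n + 1) → ω ∈ G n := fun h => hanti n.le_succ h
    simp only [Set.mem_compl_iff, Set.mem_union, Set.mem_sdiff]
    tauto
  · exact Set.disjoint_left.2 fun ω h h' => h h'.1

/-- Maximal inequality for a nonnegative process that is fair on the paths not yet stopped and
is at least `a` upon stopping. -/
theorem mul_measure_stop_add_le (hG : ∀ n, MeasurableSet (G n)) (hanti : Antitone G)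
    (hM : ∀ n, ∫⁻ ω in G n, M (n + 1) ω ∂P = ∫⁻ ω in G n, M n ω ∂P)
    {a : ℝ≥0∞} (h0 : ∀ ω ∉ G 0, a ≤ M 0 ω)
    (ha : ∀ n, ∀ ω ∈ G n \ G (n + 1), a ≤ M (n + 1) ω) (n : ℕ) :
    a * P (G n)ᶜ + ∫⁻ ω in G n, M n ω ∂P ≤ ∫⁻ ω, M 0 ω ∂P := by
  induction n with
  | zero =>
    rw [← lintegral_add_compl (μ := P) _ (hG 0), add_comm]
    gcongr
    rw [← setLIntegral_const]
    exact setLIntegral_mono' (hG 0).compl h0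
  | succ n ih =>
    refine le_trans ?_ ih
    rw [setLIntegral_eq_add_of_stop hG hanti hM n, measure_compl_succ_of_antitone hG hanti,
      mul_add, add_assoc, add_comm (lintegral _ _)]
    gcongr
    rw [← setLIntegral_const]
    exact setLIntegral_mono' ((hG n).diff (hG (n + 1))) (ha n)

/-- Converse bound for a nonnegative process that is fair on the paths not yet stopped and
is at most `b` upon stopping. -/
theorem le_mul_measure_stop_add (hG : ∀ n, MeasurableSet (G n)) (hanti : Antitone G)
    (hM : ∀ n, ∫⁻ ω in G n, M (n + 1) ω ∂P = ∫⁻ ω in G n, M n ω ∂P)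
    {b : ℝ≥0∞} (h0 : ∀ ω ∉ G 0, M 0 ω ≤ b)
    (hb : ∀ n, ∀ᵐ ω ∂P, ω ∈ G n \ G (n + 1) → M (n + 1) ω ≤ b) (n : ℕ) :
    ∫⁻ ω, M 0 ω ∂P ≤ b * P (G n)ᶜ + ∫⁻ ω in G n, M n ω ∂P := by
  induction n with
  | zero =>
    rw [← lintegral_add_compl (μ := P) _ (hG 0), add_comm]
    gcongr
    rw [← setLIntegral_const]
    exact setLIntegral_mono' (hG 0).compl h0
  | succ n ih =>
    refine ih.trans ?_
    rw [setLIntegral_eq_add_of_stop hG hanti hM n, measure_compl_succ_of_antitone hG hanti,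
      mul_add, add_assoc, add_comm (lintegral _ _)]
    gcongr
    rw [← setLIntegral_const]
    exact setLIntegral_mono_ae' ((hG n).diff (hG (n + 1))) (hb n)

end Stopping

/-! ### Exponential martingales of random walks -/

section Walk

variable {Ω : Type*} {Y : ℕ → Ω → ℝ}

/-- The paths of the random walk with steps `Y` that have avoided `C k` at all times `k ≤ n`. -/
def avoids (Y : ℕ → Ω → ℝ) (C : ℕ → Set ℝ) (n : ℕ) : Set Ω :=
  {ω | ∀ k ≤ n, ∑ j ∈ Finset.range k, Y j ω ∉ C k}

theorem avoids_antitone (C : ℕ → Set ℝ) : Antitone (avoids Y C) :=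
  fun _ _ h _ hω k hk => hω k (hk.trans h)

theorem mem_of_avoids_sdiff {C : ℕ → Set ℝ} {n : ℕ} {ω : Ω}
    (h : ω ∈ avoids Y C n \ avoids Y C (n + 1)) :
    ∑ j ∈ Finset.range (n + 1), Y j ω ∈ C (n + 1) := by
  by_contra hc
  refine h.2 fun k hk => ?_
  rcases Nat.le_succ_iff.1 hk with hk | rfl
  exacts [h.1 k hk, hc]

/-- The information in the first `n` steps. -/
abbrev pastSteps (Y : ℕ → Ω → ℝ) (n : ℕ) : MeasurableSpace Ω :=
  ⨆ j ∈ Set.Iio n, (inferInstance : MeasurableSpace ℝ).comap (Y j)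

theorem measurable_pastSteps {j n : ℕ} (h : j < n) : Measurable[pastSteps Y n] (Y j) :=
  measurable_iff_comap_le.2 (le_iSup₂_of_le (f := fun j (_ : j ∈ Set.Iio n) =>
    (inferInstance : MeasurableSpace ℝ).comap (Y j)) j h le_rfl)

theorem measurableSet_avoids_pastSteps {C : ℕ → Set ℝ} (hC : ∀ k, MeasurableSet (C k)) (n : ℕ) :
    MeasurableSet[pastSteps Y n] (avoids Y C n) := by
  have : avoids Y C n = ⋂ k, ⋂ _ : k ≤ n,
      (fun ω => ∑ j ∈ Finset.range k, Y j ω) ⁻¹' (C k)ᶜ := by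
    ext ω; simp [avoids]
  rw [this]
  refine MeasurableSet.iInter fun k => MeasurableSet.iInter fun hk => ?_
  refine (Finset.measurable_fun_sum (m := pastSteps Y n) _ fun j hj => ?_) (hC k).compl
  exact measurable_pastSteps ((Finset.mem_range.1 hj).trans_le hk)

/-- The product of the exponential weights of the first `n` steps. -/
theorem prod_ofReal_exp (r c : ℝ) (n : ℕ) (ω : Ω) :
    ∏ j ∈ Finset.range n, ENNReal.ofReal (Real.exp (-r * Y j ω + c)) =
      ENNReal.ofReal (Real.exp (-r * ∑ j ∈ Finset.range n, Y j ω + n * c)) := by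
  rw [← ENNReal.ofReal_prod_of_nonneg fun _ _ => (Real.exp_pos _).le, ← Real.exp_sum,
    Finset.sum_add_distrib, ← Finset.mul_sum]
  simp

variable [MeasurableSpace Ω] {P : Measure Ω}

theorem pastSteps_le (hY : ∀ j, Measurable (Y j)) (n : ℕ) :
    pastSteps Y n ≤ ‹MeasurableSpace Ω› :=
  iSup₂_le fun j _ => (hY j).comap_le

theorem measurableSet_avoids (hY : ∀ j, Measurable (Y j)) {C : ℕ → Set ℝ}
    (hC : ∀ k, MeasurableSet (C k)) (n : ℕ) : MeasurableSet (avoids Y C n) :=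
  pastSteps_le hY n _ (measurableSet_avoids_pastSteps hC n)

/-- A product of independent mean-one factors is fair on events of the past. -/
theorem setLIntegral_prod_succ (hY : ∀ j, Measurable (Y j)) (hind : iIndepFun Y P)
    {φ : ℝ → ℝ≥0∞} (hφ : Measurable φ) (hone : ∀ j, ∫⁻ ω, φ (Y j ω) ∂P = 1) (n : ℕ)
    {A : Set Ω} (hA : MeasurableSet[pastSteps Y n] A) :
    ∫⁻ ω in A, ∏ j ∈ Finset.range (n + 1), φ (Y j ω) ∂P =
      ∫⁻ ω in A, ∏ j ∈ Finset.range n, φ (Y j ω) ∂P := by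
  have hA' := pastSteps_le hY n _ hA
  have hi : Indep (pastSteps Y n) ((inferInstance : MeasurableSpace ℝ).comap (Y n)) P := by
    have := indep_iSup_of_disjoint (fun j => (hY j).comap_le) hind
      (S := Set.Iio n) (T := {n}) (by simp)
    simpa [pastSteps] using this
  rw [← lintegral_indicator hA', ← lintegral_indicator hA']
  have := lintegral_mul_eq_lintegral_mul_lintegral_of_independent_measurableSpace
    (f := A.indicator fun ω => ∏ j ∈ Finset.range n, φ (Y j ω)) (g := fun ω => φ (Y n ω))
    (pastSteps_le hY n) (hY n).comap_le hi
    (Measurable.indicator (Finset.measurable_fun_prod (m := pastSteps Y n) _ fun j hj =>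
      hφ.comp (measurable_pastSteps (Finset.mem_range.1 hj))) hA)
    (hφ.comp (comap_measurable (Y n)))
  rw [hone, mul_one] at this
  rw [← this]
  congr 1 with ω
  by_cases h : ω ∈ A <;> simp [h, Finset.prod_range_succ]

/-- Exponential maximal inequality for a random walk. -/
theorem mul_measure_walk_add_le [IsProbabilityMeasure P] (hY : ∀ j, Measurable (Y j))
    (hind : iIndepFun Y P) {r c : ℝ}
    (hone : ∀ j, ∫⁻ ω, ENNReal.ofReal (Real.exp (-r * Y j ω + c)) ∂P = 1)
    {C : ℕ → Set ℝ} (hC : ∀ k, MeasurableSet (C k)) {a : ℝ}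
    (ha : ∀ k, ∀ s ∈ C k, a ≤ -r * s + k * c) (n : ℕ) :
    ENNReal.ofReal (Real.exp a) * P (avoids Y C n)ᶜ +
      ∫⁻ ω in avoids Y C n,
        ENNReal.ofReal (Real.exp (-r * ∑ j ∈ Finset.range n, Y j ω + n * c)) ∂P ≤ 1 := by
  have := mul_measure_stop_add_le (P := P) (G := avoids Y C)
    (M := fun n ω => ENNReal.ofReal (Real.exp (-r * ∑ j ∈ Finset.range n, Y j ω + n * c)))
    (a := ENNReal.ofReal (Real.exp a))
    (measurableSet_avoids hY hC) (avoids_antitone C) ?_ ?_ ?_ n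
  · simpa using this
  · intro n
    simp_rw [← prod_ofReal_exp]
    exact setLIntegral_prod_succ hY hind
      (φ := fun y => ENNReal.ofReal (Real.exp (-r * y + c))) (by fun_prop) hone n
      (measurableSet_avoids_pastSteps hC n)
  · intro ω hω
    have : (0 : ℝ) ∈ C 0 := by simpa [avoids] using hω
    simpa using ha 0 0 this
  · intro n ω hω
    exact ENNReal.ofReal_le_ofReal (Real.exp_le_exp.2 (ha _ _ (mem_of_avoids_sdiff hω)))

/-- The converse of the exponential maximal inequality for a random walk with bounded
overshoot. -/
theorem le_mul_measure_walk_add [IsProbabilityMeasure P] (hY : ∀ j, Measurable (Y j))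
    (hind : iIndepFun Y P) {r c : ℝ}
    (hone : ∀ j, ∫⁻ ω, ENNReal.ofReal (Real.exp (-r * Y j ω + c)) ∂P = 1)
    {C : ℕ → Set ℝ} (hC : ∀ k, MeasurableSet (C k)) {b : ℝ} (h0 : (0 : ℝ) ∈ C 0 → 0 ≤ b)
    (hb : ∀ n, ∀ᵐ ω ∂P, ∑ j ∈ Finset.range n, Y j ω ∉ C n →
      -r * ∑ j ∈ Finset.range (n + 1), Y j ω + (n + 1 : ℕ) * c ≤ b) (n : ℕ) :
    1 ≤ ENNReal.ofReal (Real.exp b) * P (avoids Y C n)ᶜ +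
      ∫⁻ ω in avoids Y C n,
        ENNReal.ofReal (Real.exp (-r * ∑ j ∈ Finset.range n, Y j ω + n * c)) ∂P := by
  have := le_mul_measure_stop_add (P := P) (G := avoids Y C)
    (M := fun n ω => ENNReal.ofReal (Real.exp (-r * ∑ j ∈ Finset.range n, Y j ω + n * c)))
    (b := ENNReal.ofReal (Real.exp b))
    (measurableSet_avoids hY hC) (avoids_antitone C) ?_ ?_ ?_ n
  · simpa using this
  · intro n
    simp_rw [← prod_ofReal_exp]
    exact setLIntegral_prod_succ hY hind
      (φ := fun y => ENNReal.ofReal (Real.exp (-r * y + c))) (by fun_prop) hone n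
      (measurableSet_avoids_pastSteps hC n)
  · intro ω hω
    have : (0 : ℝ) ∈ C 0 := by simpa [avoids] using hω
    simpa using h0 this
  · intro n
    filter_upwards [hb n] with ω h hω
    exact ENNReal.ofReal_le_ofReal (Real.exp_le_exp.2 (h (hω.1 n le_rfl)))

end Walk

/-! ### The Poisson process on a grid -/

section Grid

/-- The Laplace transform of the Poisson distribution. -/
theorem lintegral_exp_poissonMeasure (m : ℝ≥0) (r : ℝ) :
    ∫⁻ n : ℕ, ENNReal.ofReal (Real.exp (-r * n + m * (1 - Real.exp (-r)))) ∂poissonMeasure m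
      = 1 := by
  rw [poissonMeasure, lintegral_sum_measure]
  simp_rw [lintegral_smul_measure, lintegral_dirac, smul_eq_mul,
    ← ENNReal.ofReal_mul (show (0 : ℝ) ≤ Real.exp (-m) * m ^ _ / (Nat.factorial _) by positivity)]
  -- Exponential tilting turns the Poisson weights of mean `m` into those of mean `m e^{-r}`.
  have h := hasSum_one_poissonMeasure (m * (Real.exp (-r)).toNNReal)
  have h2 : ∀ n : ℕ, Real.exp (-m) * (m : ℝ) ^ n / n.factorial *
      Real.exp (-r * n + m * (1 - Real.exp (-r))) =
      Real.exp (-(m * (Real.exp (-r)).toNNReal : ℝ≥0)) *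
        (m * (Real.exp (-r)).toNNReal : ℝ≥0) ^ n / n.factorial := by
    intro n
    rw [NNReal.coe_mul, Real.coe_toNNReal _ (Real.exp_pos _).le, mul_pow,
      ← Real.exp_nat_mul, mul_div_assoc, mul_div_assoc,
      show -r * n + m * (1 - Real.exp (-r)) = m + -(m * Real.exp (-r)) + n * -r by ring,
      Real.exp_add, Real.exp_add, Real.exp_neg (m : ℝ)]
    have := (Real.exp_pos (m : ℝ)).ne'
    field_simp
  simp_rw [h2]
  rw [← ENNReal.ofReal_tsum_of_nonneg (fun n => by positivity) h.summable, h.tsum_eq,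
    ENNReal.ofReal_one]

variable {Ω : Type*} [MeasurableSpace Ω] {P : Measure Ω} {N : ℝ≥0 → Ω → ℕ} {R : ℝ≥0}

/-- Along the grid of mesh `δ` a Poisson process is a random walk with measurable independent
steps. -/
theorem IsPoissonProcess.exists_walk (hN : IsPoissonProcess N R P) (δ : ℝ≥0) :
    ∃ Y : ℕ → Ω → ℝ, (∀ j, Measurable (Y j)) ∧ iIndepFun Y P ∧
      (∀ r : ℝ, ∀ j, ∫⁻ ω, ENNReal.ofReal
        (Real.exp (-r * Y j ω + R * δ * (1 - Real.exp (-r)))) ∂P = 1) ∧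
      ∀ᵐ ω ∂P, ∀ k : ℕ, ∑ j ∈ Finset.range k, Y j ω = N (k * δ) ω := by
  have hmono : Monotone fun k : ℕ => (k : ℝ≥0) * δ := fun a b h => by
    dsimp only; gcongr
  have hlaw : ∀ j : ℕ, HasLaw
      (fun ω => (N ((j + 1 : ℕ) * δ) ω : ℝ) - (N (j * δ) ω : ℝ))
      ((poissonMeasure (R * δ)).map (Nat.cast : ℕ → ℝ)) P := fun j => by
    have h := hN.law_increments _ _ (hmono j.le_succ)
    have h' : ((j.succ : ℝ≥0) * δ - j * δ) = δ := by
      rw [← tsub_mul]; simp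
    rwa [h'] at h
  -- The increments are only a.e. measurable, so the steps are measurable versions of them.
  refine ⟨fun j => (hlaw j).aemeasurable.mk _, fun j => (hlaw j).aemeasurable.measurable_mk,
    ?_, fun r j => ?_, ?_⟩
  · exact (hN.indep_increments.nat hmono).congr fun j => (hlaw j).aemeasurable.ae_eq_mk
  · have h1 : ∫⁻ ω, ENNReal.ofReal (Real.exp (-r * (hlaw j).aemeasurable.mk _ ω +
        R * δ * (1 - Real.exp (-r)))) ∂P = ∫⁻ ω, ENNReal.ofReal (Real.exp (-r *
          ((N ((j + 1 : ℕ) * δ) ω : ℝ) - (N (j * δ) ω : ℝ)) +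
        R * δ * (1 - Real.exp (-r)))) ∂P := by
      refine lintegral_congr_ae ?_
      filter_upwards [(hlaw j).aemeasurable.ae_eq_mk] with ω hω
      rw [← hω]
    have h2 := (hlaw j).lintegral_comp (f := fun x => ENNReal.ofReal (Real.exp (-r * x +
      R * δ * (1 - Real.exp (-r))))) (by fun_prop)
    rw [h1, h2, lintegral_map (by fun_prop) .of_discrete]
    simpa using lintegral_exp_poissonMeasure (R * δ) r
  · filter_upwards [hN.start_zero, ae_all_iff.2 fun j => (hlaw j).aemeasurable.ae_eq_mk]
      with ω h0 h k
    simp_rw [← h, Finset.sum_range_sub (fun j : ℕ => (N (j * δ) ω : ℝ))]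
    simp [h0]

end Grid

/-! ### Maximal inequality in continuous time -/

section

variable {Ω : Type*} [MeasurableSpace Ω] {P : Measure Ω} {N : ℝ≥0 → Ω → ℕ} {R : ℝ≥0}

/-- The values are discrete, so right continuity means being constant just to the right of `t`. -/
theorem exists_const_Ico {f : ℝ≥0 → ℕ} {t : ℝ≥0} (h : ContinuousWithinAt f (Set.Ici t) t) :
    ∃ u > t, ∀ s ∈ Set.Ico t u, f s = f t := by
  have h1 : ∀ᶠ s in nhdsWithin t (Set.Ici t), f s = f t :=
    h (IsOpen.mem_nhds (isOpen_discrete {f t}) rfl)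
  obtain ⟨u, hu, hs⟩ := mem_nhdsGE_iff_exists_Ico_subset.1 h1
  exact ⟨u, hu, fun s h => hs h⟩

theorem exists_dyadic_mem_Ico {t u : ℝ≥0} (h : t < u) :
    ∃ m k : ℕ, (k : ℝ≥0) * (1 / 2) ^ m ∈ Set.Ico t u := by
  obtain ⟨m, hm⟩ := exists_pow_lt_of_lt_one (tsub_pos_of_lt h) (show (1 / 2 : ℝ≥0) < 1 by norm_num)
  have hp : (0 : ℝ≥0) < (1 / 2) ^ m := by positivity
  refine ⟨m, ⌈t / (1 / 2) ^ m⌉₊, (div_le_iff₀ hp).1 (Nat.le_ceil _), ?_⟩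
  calc (⌈t / (1 / 2) ^ m⌉₊ : ℝ≥0) * (1 / 2) ^ m
      < (t / (1 / 2) ^ m + 1) * (1 / 2) ^ m := by
        gcongr
        exact Nat.ceil_lt_add_one zero_le
    _ = t + (1 / 2) ^ m := by
        rw [add_mul, one_mul, div_mul_cancel₀ _ hp.ne']
    _ < u := by
        rw [add_comm]; exact lt_tsub_iff_right.1 hm

/-- Exponential maximal inequality for a compensated Poisson process along a grid. -/
theorem IsPoissonProcess.measure_grid_le [IsProbabilityMeasure P] (hN : IsPoissonProcess N R P)
    (δ T : ℝ≥0) (y : ℝ) {r : ℝ} (hr : 0 ≤ r) (hγ : gammaFun R r ≤ 0) :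
    P {ω | ∃ k : ℕ, T ≤ k * δ ∧ (N (k * δ) ω : ℝ) - (k * δ : ℝ≥0) ≤ y} ≤
      ENNReal.ofReal (Real.exp (r * y + gammaFun R r * T)) := by
  obtain ⟨Y, hY, hind, hone, hsum⟩ := hN.exists_walk δ
  let C : ℕ → Set ℝ := fun k => {s | T ≤ k * δ ∧ s - (k * δ : ℝ≥0) ≤ y}
  have hC : ∀ k, MeasurableSet (C k) := fun k =>
    (MeasurableSet.const _).inter (measurableSet_le (measurable_id.sub_const _) measurable_const)
  have hbound : ∀ n, P (avoids Y C n)ᶜ ≤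
      ENNReal.ofReal (Real.exp (r * y + gammaFun R r * T)) := by
    intro n
    have h := mul_measure_walk_add_le (P := P) hY hind (hone r) hC
      (a := -(r * y + gammaFun R r * T)) ?_ n
    · replace h := le_self_add.trans h
      rw [Real.exp_neg, ENNReal.ofReal_inv_of_pos (Real.exp_pos _), mul_comm,
        ← div_eq_mul_inv] at h
      simpa using (ENNReal.div_le_iff (by simp [Real.exp_pos]) (by simp)).1 h
    · rintro k s ⟨h1, h2⟩
      have h1' : (T : ℝ) ≤ k * δ := mod_cast h1
      push_cast at h2
      have h3 := mul_le_mul_of_nonneg_left h2 hr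
      have h4 := mul_le_mul_of_nonpos_left h1' hγ
      have h5 : gammaFun R r * (k * δ) =
        r * (k * δ) - k * (R * δ * (1 - Real.exp (-r))) := by unfold gammaFun; ring
      linarith
  have hmono : Monotone fun n => (avoids Y C n)ᶜ := fun m n h =>
    Set.compl_subset_compl.2 (avoids_antitone C h)
  refine le_trans (measure_mono_ae (t := ⋃ n, (avoids Y C n)ᶜ) ?_) ?_
  · filter_upwards [hsum] with ω hω
    rintro ⟨k, hk⟩
    refine Set.mem_iUnion.2 ⟨k, fun h => h k le_rfl ?_⟩
    rw [hω]
    exact hk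
  · rw [hmono.measure_iUnion]
    exact iSup_le hbound

/-- Exponential maximal inequality for a compensated Poisson process. -/
theorem IsPoissonProcess.measure_exists_le [IsProbabilityMeasure P] (hN : IsPoissonProcess N R P)
    (T : ℝ≥0) (y : ℝ) {r : ℝ} (hr : 0 ≤ r) (hγ : gammaFun R r ≤ 0) :
    P {ω | ∃ t : ℝ≥0, T ≤ t ∧ (N t ω : ℝ) - t ≤ y} ≤
      ENNReal.ofReal (Real.exp (r * y + gammaFun R r * T)) := by
  let J : ℕ → Set Ω := fun m => {ω | ∃ k : ℕ, T ≤ k * (1 / 2) ^ m ∧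
    (N (k * (1 / 2) ^ m) ω : ℝ) - (k * (1 / 2) ^ m : ℝ≥0) ≤ y}
  have hJ : Monotone J := by
    refine monotone_nat_of_le_succ fun m ω => ?_
    rintro ⟨k, hk⟩
    refine ⟨k * 2, ?_⟩
    rwa [show ((k * 2 : ℕ) : ℝ≥0) * (1 / 2) ^ (m + 1) = k * (1 / 2) ^ m by
      push_cast; rw [pow_succ]; field_simp]
  refine le_trans (measure_mono_ae (t := ⋃ m, J m) ?_) ?_
  · filter_upwards [hN.right_continuous] with ω hω
    rintro ⟨t, hT, ht⟩
    obtain ⟨u, hu, hc⟩ := exists_const_Ico (hω t)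
    obtain ⟨m, k, hk⟩ := exists_dyadic_mem_Ico hu
    refine Set.mem_iUnion.2 ⟨m, k, hT.trans hk.1, ?_⟩
    -- At the dyadic point `N` is unchanged while the clock has advanced, so `N - t` can only be
    -- smaller.
    rw [hc _ hk]
    have : (t : ℝ) ≤ (k * (1 / 2) ^ m : ℝ≥0) := hk.1
    linarith
  · rw [hJ.measure_iUnion]
    exact iSup_le fun m => hN.measure_grid_le _ T y hr hγ

/-! ### The exponent `log R`, where `γ` is minimal -/

theorem gammaFun_log {R : ℝ} (hR : 0 < R) : gammaFun R (Real.log R) = Real.log R + 1 - R := by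
  rw [gammaFun, Real.exp_neg, Real.exp_log hR]
  field_simp
  ring

theorem gammaFun_log_le {R : ℝ} (hR : 0 < R) :
    gammaFun R (Real.log R) ≤ -((R - 1) ^ 2 / (4 * (R + 1))) := by
  have hs := Real.sqrt_pos.2 hR
  have hsq := Real.sq_sqrt hR.le
  -- Through `log R = 2 log √R` this yields `γ(log R) ≤ -(√R - 1)^2`.
  have h1 : Real.log R ≤ 2 * (√R - 1) := by
    have h := Real.log_le_sub_one_of_pos hs
    rw [Real.log_sqrt hR.le] at h
    linarith
  have h2 : (R - 1) ^ 2 / (4 * (R + 1)) ≤ (√R - 1) ^ 2 := by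
    rw [div_le_iff₀ (by positivity)]
    have h3 : (R - 1) ^ 2 = (√R - 1) ^ 2 * (√R + 1) ^ 2 := by
      nth_rw 1 [← hsq]; ring
    rw [h3]
    gcongr
    nlinarith [sq_nonneg (√R - 1)]
  rw [gammaFun_log hR]
  nlinarith

theorem gammaFun_log_neg {R : ℝ} (hR : 1 < R) : gammaFun R (Real.log R) < 0 := by
  refine (gammaFun_log_le (by linarith)).trans_lt (neg_neg_of_pos ?_)
  have : 0 < R - 1 := by linarith
  have : 0 < R + 1 := by linarith
  positivity

/-- `γ` is negative at `log R` and `γ(R) = R e^{-R} > 0`, so a root lies between. -/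
theorem log_le_rBar {R : ℝ} (hR : 1 < R) : Real.log R ≤ rBar R := by
  have h0 : 0 < R := by linarith
  have h1 : Real.log R ≤ R := (Real.log_le_sub_one_of_pos h0).trans (by linarith)
  have hc : ContinuousOn (gammaFun R) (Set.Icc (Real.log R) R) := by
    unfold gammaFun; fun_prop
  obtain ⟨x, hx, hx0⟩ := intermediate_value_Icc h1 hc
    (show (0 : ℝ) ∈ _ from ⟨(gammaFun_log_neg hR).le, by
      unfold gammaFun; nlinarith [Real.exp_pos (-R)]⟩)
  exact hx.1.trans ((isGreatest_rBar h0.le).2 hx0)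

/-- Lower bound for the probability that the buffer runs empty, along a finite grid. -/
theorem IsPoissonProcess.one_le_grid [IsProbabilityMeasure P] (hN : IsPoissonProcess N R P)
    (D : ℝ≥0) {r ρ : ℝ} (hρ : ρ ≤ r) (hr : 0 ≤ r) (hγ : gammaFun R r = 0)
    {δ : ℝ≥0} (n : ℕ) :
    1 ≤ ENNReal.ofReal (Real.exp (r * (D + δ))) *
        P {ω | ∃ t : ℝ≥0, bufferSize N D t ω ≤ 0} +
      ENNReal.ofReal (Real.exp ((r - ρ) * D + n * (δ * gammaFun R ρ))) := by
  obtain ⟨Y, hY, hind, hone, hsum⟩ := hN.exists_walk δ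
  let C : ℕ → Set ℝ := fun k => {s | D + s - k * δ ≤ 0}
  have hC : ∀ k, MeasurableSet (C k) := fun k => measurableSet_le (by fun_prop) (by fun_prop)
  refine (le_mul_measure_walk_add (P := P) hY hind (hone r) hC (b := r * (D + δ))
    (fun _ => by positivity) ?_ n).trans ?_
  · intro n
    filter_upwards [hsum, hN.monotone_paths] with ω hω hmono h
    rw [hω] at h ⊢
    have h1 : 0 < (D : ℝ) + N (n * δ) ω - n * δ := not_le.1 h
    have h2 : (N (n * δ) ω : ℝ) ≤ N ((n + 1 : ℕ) * δ) ω := by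
      exact_mod_cast hmono (show (n : ℝ≥0) * δ ≤ ((n + 1 : ℕ) : ℝ≥0) * δ by gcongr; simp)
    have h3 : R * δ * (1 - Real.exp (-r)) = r * δ := by
      have : (R : ℝ) * (1 - Real.exp (-r)) = r := by unfold gammaFun at hγ; linarith
      linear_combination (δ : ℝ) * this
    rw [h3]
    push_cast
    push_cast at h2
    -- Arrivals only raise the buffer, so one step takes it from positive to no lower than `-δ`.
    have h4 : (n : ℝ) * δ - D ≤ N ((n + 1) * δ) ω := by linarith
    have := mul_le_mul_of_nonneg_left h4 hr
    linarith
  refine add_le_add (mul_le_mul' le_rfl ?_) ?_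
  · refine measure_mono_ae ?_
    filter_upwards [hsum] with ω hω h
    have h' : ∃ k ≤ n, ∑ j ∈ Finset.range k, Y j ω ∈ C k := by
      by_contra hcon
      push Not at hcon
      exact h hcon
    obtain ⟨k, -, hk⟩ := h'
    rw [hω] at hk
    exact ⟨k * δ, by simpa [bufferSize, C] using hk⟩
  -- With nothing to avoid, this says that the weight with exponent `ρ` has mean at most one.
  · have h := mul_measure_walk_add_le (P := P) hY hind (hone ρ) (C := fun _ => ∅)
      (fun _ => MeasurableSet.empty) (a := 0) (by simp) n
    have h1 : avoids Y (fun _ => ∅) n = Set.univ := by simp [avoids]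
    rw [h1] at h
    simp only [Set.compl_univ, measure_empty, mul_zero, zero_add, Measure.restrict_univ] at h
    calc ∫⁻ ω in avoids Y C n, ENNReal.ofReal (Real.exp (-r * ∑ j ∈ Finset.range n, Y j ω +
          n * (R * δ * (1 - Real.exp (-r))))) ∂P
        ≤ ∫⁻ ω in avoids Y C n,
          ENNReal.ofReal (Real.exp ((r - ρ) * D + n * (δ * gammaFun R ρ))) *
          ENNReal.ofReal (Real.exp (-ρ * ∑ j ∈ Finset.range n, Y j ω +
            n * (R * δ * (1 - Real.exp (-ρ))))) ∂P := by
          refine setLIntegral_mono' (measurableSet_avoids hY hC n) fun ω hω => ?_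
          rw [← ENNReal.ofReal_mul (Real.exp_pos _).le, ← Real.exp_add]
          refine ENNReal.ofReal_le_ofReal (Real.exp_le_exp.2 ?_)
          have h1 : 0 < (D : ℝ) + ∑ j ∈ Finset.range n, Y j ω - n * δ := not_le.1 (hω n le_rfl)
          -- Survival bounds the walk below, which allows lowering the exponent from `r` to `ρ` at
          -- cost `(r - ρ) D`.
          have h2 := mul_nonneg (sub_nonneg.2 hρ) h1.le
          unfold gammaFun at hγ ⊢
          have h3 : n * (R * δ * (1 - Real.exp (-r))) = n * δ * r := by
            linear_combination (-(n : ℝ) * δ) * hγ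
          rw [h3]
          linarith
      _ ≤ ∫⁻ ω, ENNReal.ofReal (Real.exp ((r - ρ) * D + n * (δ * gammaFun R ρ))) *
          ENNReal.ofReal (Real.exp (-ρ * ∑ j ∈ Finset.range n, Y j ω +
            n * (R * δ * (1 - Real.exp (-ρ))))) ∂P := setLIntegral_le_lintegral _ _
      _ ≤ _ := by
          rw [lintegral_const_mul' _ _ ENNReal.ofReal_ne_top]
          exact mul_le_of_le_one_right' h

/-- The probability that the buffer ever runs empty. -/
theorem IsPoissonProcess.measure_empty_eq [IsProbabilityMeasure P] (hN : IsPoissonProcess N R P)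
    (hR : 1 < R) (D : ℝ≥0) :
    P {ω | ∃ t : ℝ≥0, bufferSize N D t ω ≤ 0} = ENNReal.ofReal (Real.exp (-(rBar R * D))) := by
  have hR' : (1 : ℝ) < R := mod_cast hR
  have hγ : gammaFun R (rBar R) = 0 := (isGreatest_rBar R.coe_nonneg).1
  have hlog := log_le_rBar hR'
  have hr : 0 ≤ rBar R := (Real.log_nonneg hR'.le).trans hlog
  set r := rBar (R : ℝ)
  set H := {ω | ∃ t : ℝ≥0, bufferSize N D t ω ≤ 0} with hH
  apply le_antisymm
  · have h := hN.measure_exists_le 0 (-(D : ℝ)) hr hγ.le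
    have h' : {ω | ∃ t : ℝ≥0, (0 : ℝ≥0) ≤ t ∧ (N t ω : ℝ) - t ≤ -D} = H := by
      ext ω
      simp only [hH, bufferSize, Set.mem_ofPred_eq, zero_le, true_and]
      refine exists_congr fun t => ⟨fun h => by linarith, fun h => by linarith⟩
    rw [h'] at h
    simpa using h
  -- For fixed mesh the horizon `n` goes to infinity, with `ρ = log R`; only then does `δ` go to
  -- `0`.
  · have h1 : ∀ δ : ℝ≥0, 0 < δ → 1 ≤ ENNReal.ofReal (Real.exp (r * (D + δ))) * P H := by
      intro δ hδ
      have hδ' : (0 : ℝ) < δ := mod_cast hδ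
      have hneg : δ * gammaFun R (Real.log R) < 0 :=
        mul_neg_of_pos_of_neg hδ' (gammaFun_log_neg hR')
      refine ge_of_tendsto' (x := Filter.atTop) (f := fun n : ℕ =>
        ENNReal.ofReal (Real.exp (r * (D + δ))) * P H + ENNReal.ofReal
          (Real.exp ((r - Real.log R) * D + n * (δ * gammaFun R (Real.log R))))) ?_
        fun n => hN.one_le_grid D hlog hr hγ n
      have ht : Filter.Tendsto (fun n : ℕ => Real.exp ((r - Real.log R) * D +
          n * (δ * gammaFun R (Real.log R)))) Filter.atTop (nhds 0) :=
        Real.tendsto_exp_atBot.comp (Filter.tendsto_atBot_add_const_left _ _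
          (tendsto_natCast_atTop_atTop.atTop_mul_const_of_neg hneg))
      simpa using (ENNReal.tendsto_ofReal ht).const_add
        (ENNReal.ofReal (Real.exp (r * (D + δ))) * P H)
    have h2 : (1 : ℝ≥0∞) ≤ ENNReal.ofReal (Real.exp (r * D)) * P H := by
      have ht : Filter.Tendsto (fun δ : ℝ≥0 => ENNReal.ofReal (Real.exp (r * (D + δ))) * P H)
          (nhdsWithin 0 (Set.Ioi 0))
          (nhds (ENNReal.ofReal (Real.exp (r * (D + (0 : ℝ≥0)))) * P H)) := by
        refine ENNReal.Tendsto.mul_const ?_ (Or.inr (measure_ne_top _ _))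
        refine ENNReal.tendsto_ofReal ?_
        refine (Continuous.tendsto ?_ 0).mono_left nhdsWithin_le_nhds
        fun_prop
      simpa using ge_of_tendsto ht (by filter_upwards [self_mem_nhdsWithin] with δ hδ using h1 δ hδ)
    rw [Real.exp_neg, ENNReal.ofReal_inv_of_pos (Real.exp_pos _)]
    exact (ENNReal.inv_le_iff_le_mul (fun h => absurd h (measure_ne_top _ _))
      (fun h => absurd h ENNReal.ofReal_ne_top)).2 h2

end

/-! ### Emptying and completion times -/

section

variable {Ω : Type*} {N : ℝ≥0 → Ω → ℕ} {D : ℝ≥0} {ω : Ω}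

theorem emptyTime_le {t : ℝ≥0} (h : bufferSize N D t ω ≤ 0) : emptyTime N D ω ≤ t :=
  iInf₂_le t h

theorem exists_of_emptyTime_lt_top (h : emptyTime N D ω < ⊤) :
    ∃ t, bufferSize N D t ω ≤ 0 := by
  by_contra! hcon
  exact absurd h (by simp [emptyTime, not_le.2 (hcon _)])

theorem finishTime_top : finishTime N D ⊤ ω = ⊤ := by
  simp only [finishTime, iInf_eq_top]
  intro t ht
  simp at ht

theorem finishTime_coe_condition {F t : ℝ≥0} :
    (((F : ℝ≥0∞) : EReal) - ((t : ℝ) : EReal) ≤ ((bufferSize N D t ω : ℝ) : EReal)) ↔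
      (F : ℝ) ≤ D + N t ω := by
  have : ((F : ℝ≥0∞) : EReal) = ((F : ℝ) : EReal) := rfl
  rw [this, ← EReal.coe_sub, EReal.coe_le_coe_iff, bufferSize]
  constructor <;> intro h <;> linarith

/-- If the download is complete by time `t`, the packets received by then make up the file. -/
theorem le_of_finishTime_le {F t : ℝ≥0} (hmono : Monotone fun t => N t ω)
    (hc : ContinuousWithinAt (fun s => N s ω) (Set.Ici t) t)
    (h : finishTime N D F ω ≤ t) : (F : ℝ) ≤ D + N t ω := by
  obtain ⟨u, hu, hconst⟩ := exists_const_Ico hc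
  -- Attainment of the infimum is not known; a completion time before `u` suffices, since `N` is
  -- constant on `[t, u)`.
  have h1 : finishTime N D F ω < u := h.trans_lt (mod_cast hu)
  simp only [finishTime, iInf_lt_iff, finishTime_coe_condition] at h1
  obtain ⟨s, hs, hsu⟩ := h1
  have hsu' : s < u := mod_cast hsu
  have h2 : N s ω ≤ N t ω := by
    rcases le_total s t with hst | hts
    · exact hmono hst
    · exact (hconst s ⟨hts, hsu'⟩).le
  have h3 : (N s ω : ℝ) ≤ N t ω := mod_cast h2
  linarith

end

end Streaming

theorem mainTheorem1 {Ω : Type*} [MeasurableSpace Ω] (P : Measure Ω) [IsProbabilityMeasure P]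
    (R : ℝ≥0) (hR : 1 < R) (N : ℝ≥0 → Ω → ℕ) (hN : Streaming.IsPoissonProcess N R P) (D : ℝ≥0) :
    (∀ F : ℝ≥0,
      Real.exp (-(Streaming.rBar R * D))
          - 2 * Real.exp (-(((R : ℝ) - 1) ^ 2 / (4 * ((R : ℝ) + 1)) * F))
        ≤ Streaming.interruptionProb N D P F ∧
      Streaming.interruptionProb N D P F ≤ Real.exp (-(Streaming.rBar R * D))) ∧
    Streaming.interruptionProb N D P ⊤ = P.real {ω | ∃ t, Streaming.bufferSize N D t ω ≤ 0} ∧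
    Streaming.interruptionProb N D P ⊤ = Real.exp (-(Streaming.rBar R * D)) := by
  have hR' : (1 : ℝ) < R := mod_cast hR
  have hR0 : (0 : ℝ) < R := by linarith
  have hH : P.real {ω | ∃ t, Streaming.bufferSize N D t ω ≤ 0} =
      Real.exp (-(Streaming.rBar R * D)) := by
    rw [measureReal_def, hN.measure_empty_eq hR D, ENNReal.toReal_ofReal (Real.exp_pos _).le]
  have htop : Streaming.interruptionProb N D P ⊤ =
      P.real {ω | ∃ t, Streaming.bufferSize N D t ω ≤ 0} := by
    unfold Streaming.interruptionProb
    congr 1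
    ext ω
    simp only [Streaming.finishTime_top, Set.mem_ofPred_eq]
    exact ⟨Streaming.exists_of_emptyTime_lt_top, fun ⟨t, ht⟩ =>
      (Streaming.emptyTime_le ht).trans_lt ENNReal.coe_lt_top⟩
  refine ⟨fun F => ⟨?_, ?_⟩, htop, htop.trans hH⟩
  · have h1 : P.real {ω | ∃ t : ℝ≥0, F ≤ t ∧ (N t ω : ℝ) - t ≤ 0} ≤
        Real.exp (-(((R : ℝ) - 1) ^ 2 / (4 * ((R : ℝ) + 1)) * F)) := by
      refine ENNReal.toReal_le_of_le_ofReal (Real.exp_pos _).le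
        ((hN.measure_exists_le F 0 (Real.log_nonneg hR'.le)
          (Streaming.gammaFun_log_neg hR').le).trans ?_)
      refine ENNReal.ofReal_le_ofReal (Real.exp_le_exp.2 ?_)
      have := mul_le_mul_of_nonneg_right (Streaming.gammaFun_log_le hR0) F.coe_nonneg
      linarith
    have h2 : P.real {ω | ∃ t, Streaming.bufferSize N D t ω ≤ 0} ≤
        Streaming.interruptionProb N D P F +
          P.real {ω | ∃ t : ℝ≥0, F ≤ t ∧ (N t ω : ℝ) - t ≤ 0} := by
      refine le_trans ?_ (measureReal_union_le _ _)
      refine ENNReal.toReal_mono (measure_ne_top _ _) (measure_mono_ae ?_)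
      filter_upwards [hN.monotone_paths, hN.right_continuous] with ω hmono hc
      rintro ⟨t, ht⟩
      rcases lt_or_ge (Streaming.emptyTime N D ω) (Streaming.finishTime N D F ω) with h | h
      · exact Or.inl h
      · have h3 := Streaming.le_of_finishTime_le hmono (hc t)
          (h.trans (Streaming.emptyTime_le ht))
        have h4 : (D : ℝ) + N t ω - t ≤ 0 := ht
        have hD := D.coe_nonneg
        exact Or.inr ⟨t, NNReal.coe_le_coe.1 (by linarith), by linarith⟩
    -- One copy of the exponential error suffices; positivity absorbs the second.
    have := Real.exp_pos (-(((R : ℝ) - 1) ^ 2 / (4 * ((R : ℝ) + 1)) * F))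
    rw [hH] at h2
    linarith
  · rw [← hH]
    exact measureReal_mono fun ω h => Streaming.exists_of_emptyTime_lt_top (lt_top_of_lt h)
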